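/- Let $1\le m\le n$ be integers and let $p=(p_1,\dots,p_n)$ be a probability distribution. For a finite probability distribution $a$ let $H(a)=-\sum_i a_i\log_2 a_i$ (with $0\log_2 0=0$). For probability distributions $p$ with $n$ components and $q$ with $m$ components let $W(p,q)$ be the minimum of $H(N)$ over all bivariate probability distributions $N$ with marginals $p$ and $q$, and put $$D(p,q)=2W(p,q)-H(p)-H(q).$$ A step of the Huffman algorithm replaces two smallest elements $x,y$ of the current list of probabilities (ties broken arbitrarily) by the single element $x+y$. Let $\bar q=(\bar q_1,\dots,\bar q_m)$ be the list, in non-increasing order, obtained from $p$ by exactly $n-m$ such steps; such a $\bar q$ always exists. Let $q^*$ be a probability distribution with $m$ components that minimizes $D(p,q)$ over all probability distributions $q$ with $m$ components; such a $q^*$ exists. Then $\bar q$ is an aggregation of $p$ into $m$ components, i.e. there is a partition of $\{1,\dots,n\}$ into nonempty sets $I_1,\dots,I_m$ with $\bar q_k=\sum_{i\in I_k}p_i$ for every $k$, and $$D(p,\bar q)\le D(p,q^*)+\alpha,\qquad \alpha=1-\frac{1+\ln(\ln 2)}{\ln 2}<0.0861 .$$ -/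

import Mathlib

namespace HuffmanApprox

/-- Shannon entropy in bits, `-∑ aᵢ log₂ aᵢ`, with the convention `0 log₂ 0 = 0`. -/
noncomputable def entropy {ι : Type*} [Fintype ι] (a : ι → ℝ) : ℝ :=
  -∑ i, a i * Real.logb 2 (a i)

/-- The bivariate probability distributions with marginals `p` and `q`. -/
def couplings {ι κ : Type*} [Fintype ι] [Fintype κ] (p : ι → ℝ) (q : κ → ℝ) :
    Set (ι × κ → ℝ) :=
  {N | N ∈ stdSimplex ℝ (ι × κ) ∧ (∀ i, ∑ j, N (i, j) = p i) ∧ (∀ j, ∑ i, N (i, j) = q j)}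

/-- The minimum entropy of a bivariate distribution with marginals `p` and `q`; the infimum is
attained, see `isLeast_minJointEntropy`. -/
noncomputable def minJointEntropy {ι κ : Type*} [Fintype ι] [Fintype κ]
    (p : ι → ℝ) (q : κ → ℝ) : ℝ :=
  sInf (entropy '' couplings p q)

/-- `D(p, q) = 2 W(p, q) - H(p) - H(q)`. -/
noncomputable def dist {ι κ : Type*} [Fintype ι] [Fintype κ] (p : ι → ℝ) (q : κ → ℝ) : ℝ :=
  2 * minJointEntropy p q - entropy p - entropy q

lemma continuous_entropy {ι : Type*} [Fintype ι] :
    Continuous (entropy : (ι → ℝ) → ℝ) := by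
  have h : Continuous fun x : ℝ => x * Real.logb 2 x := by
    have : (fun x : ℝ => x * Real.logb 2 x) = fun x => x * Real.log x / Real.log 2 := by
      funext x; simp only [Real.logb, mul_div_assoc]
    rw [this]
    exact Real.continuous_mul_log.div_const _
  unfold entropy
  exact (continuous_finsetSum _ fun i _ => h.comp (continuous_apply i)).neg

/-- For probability distributions `p` and `q`, the number `W(p, q)` is a genuine minimum. -/
theorem isLeast_minJointEntropy {ι κ : Type*} [Fintype ι] [Fintype κ]
    {p : ι → ℝ} {q : κ → ℝ} (hp : p ∈ stdSimplex ℝ ι) (hq : q ∈ stdSimplex ℝ κ) :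
    IsLeast (entropy '' couplings p q) (minJointEntropy p q) := by
  have hne : (couplings p q).Nonempty := by
    refine ⟨fun x => p x.1 * q x.2, ⟨fun x => mul_nonneg (hp.1 _) (hq.1 _), ?_⟩, ?_, ?_⟩
    · rw [Fintype.sum_prod_type]
      simp [← Finset.mul_sum, hq.2, hp.2]
    · intro i; simp [← Finset.mul_sum, hq.2]
    · intro j; simp [← Finset.sum_mul, hp.2]
  have hcl : IsClosed {N : ι × κ → ℝ |
      (∀ i, ∑ j, N (i, j) = p i) ∧ (∀ j, ∑ i, N (i, j) = q j)} := by
    simp only [Set.ofPred_and, Set.ofPred_forall]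
    refine IsClosed.inter (isClosed_iInter fun i => ?_) (isClosed_iInter fun j => ?_)
    · exact isClosed_eq (by fun_prop) continuous_const
    · exact isClosed_eq (by fun_prop) continuous_const
  have hc : IsCompact (couplings p q) := (isCompact_stdSimplex ℝ (ι × κ)).inter_right hcl
  exact (hc.image continuous_entropy).isLeast_sInf (hne.image _)

/-- `q` is a best approximation of `p` with `m` components: it minimizes `D(p, ·)` over all
probability distributions with `m` components. -/
def IsBestApprox {n m : ℕ} (p : Fin n → ℝ) (q : Fin m → ℝ) : Prop :=
  q ∈ stdSimplex ℝ (Fin m) ∧ ∀ q' ∈ stdSimplex ℝ (Fin m), dist p q ≤ dist p q'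

/-- `q` is an aggregation of `p` into `m` components. The (nonempty) blocks of the partition are
the fibres of `f`. -/
def IsAggregation {n m : ℕ} (p : Fin n → ℝ) (q : Fin m → ℝ) : Prop :=
  ∃ f : Fin n → Fin m, Function.Surjective f ∧ ∀ k, q k = ∑ i with f i = k, p i

/-- One step of the Huffman algorithm: two smallest elements `x`, `y` are deleted and replaced by
`x + y`. -/
def HuffmanStep (s t : Multiset ℝ) : Prop :=
  ∃ (x y : ℝ) (u : Multiset ℝ), s = x ::ₘ y ::ₘ u ∧ x ≤ y ∧ (∀ z ∈ u, y ≤ z) ∧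
    t = (x + y) ::ₘ u

/-- `HuffmanSteps k s t`: the multiset `t` is obtained from `s` by exactly `k` Huffman steps. -/
inductive HuffmanSteps : ℕ → Multiset ℝ → Multiset ℝ → Prop
  | zero (s : Multiset ℝ) : HuffmanSteps 0 s s
  | succ {k : ℕ} {s t u : Multiset ℝ} :
      HuffmanStep s t → HuffmanSteps k t u → HuffmanSteps (k + 1) s u

/-- `q`, listed in non-increasing order, is obtained from `p` by exactly `n - m` steps of the
Huffman algorithm (used for `m ≤ n`). -/
def IsHuffmanOutput {n m : ℕ} (p : Fin n → ℝ) (q : Fin m → ℝ) : Prop :=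
  Antitone q ∧
    HuffmanSteps (n - m) (Finset.univ.val.map p) (Finset.univ.val.map q)

/-- The constant `α = 1 - (1 + ln (ln 2)) / ln 2`. -/
noncomputable def alpha : ℝ := 1 - (1 + Real.log (Real.log 2)) / Real.log 2

end HuffmanApprox

/-!
The conditional entropy `H(X | Y) = H(X, Y) - H(Y)` is concave in the joint distribution, and the
joint distributions with first marginal `p` are the convex hull of the laws of the pairs `(X, f X)`.
Hence `D(p, ·)` is minimized at an aggregation `q` of `p`, where `D(p, q) = H(p) - H(q)`, and it
remains to compare the entropy of the Huffman output with that of any aggregation.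

A Huffman step merges the two lightest entries, so a block of the output with at least two elements
weighs at most twice the lightest block `μ`. Now replace `t ↦ -t log t` by its
difference with its tangent at `2 μ log 2`: this changes the entropies of all `m`-component
distributions by the same constant and leaves a nonpositive function which is subadditive on the
range that matters. The blocks heavier than `2 μ` are single atoms of `p`, and these atoms already
bound the sum for any aggregation from above; the other blocks lie in `[μ, 2 μ]`, where the function
is at least `-(α log 2) t`.
-/

namespace HuffmanApprox

open Finset Real

variable {ι κ τ : Type*}

/-- The distribution of `f X` when `X` has distribution `p`. -/
noncomputable def fiberSum [Fintype ι] [DecidableEq κ] (p : ι → ℝ) (f : ι → κ) (k : κ) : ℝ :=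
  ∑ i with f i = k, p i

section FiberSum

variable [Fintype ι] [DecidableEq κ] {p : ι → ℝ}

lemma sum_fiberSum [Fintype κ] (p : ι → ℝ) (f : ι → κ) : ∑ k, fiberSum p f k = ∑ i, p i :=
  sum_fiberwise _ _ _

lemma fiberSum_nonneg (hp : 0 ≤ p) (f : ι → κ) : 0 ≤ fiberSum p f := fun _ =>
  sum_nonneg fun i _ => hp i

lemma le_fiberSum (hp : 0 ≤ p) (f : ι → κ) (i : ι) : p i ≤ fiberSum p f (f i) :=
  single_le_sum (f := p) (fun j _ => hp j) (by simp)

lemma fiberSum_mem_stdSimplex [Fintype κ] (hp : p ∈ stdSimplex ℝ ι) (f : ι → κ) :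
    fiberSum p f ∈ stdSimplex ℝ κ :=
  ⟨fiberSum_nonneg hp.1 f, by rw [sum_fiberSum, hp.2]⟩

lemma fiberSum_apply_of_forall_eq {f : ι → κ} {i : ι} (hi : ∀ j, f j = f i → j = i) :
    fiberSum p f (f i) = p i := by
  have hfiber : univ.filter (fun j => f j = f i) = {i} := by
    ext j
    simpa using ⟨hi j, fun h => h ▸ rfl⟩
  rw [fiberSum, hfiber, sum_singleton]

lemma fiberSum_fiberSum [Fintype κ] [DecidableEq τ] (p : ι → ℝ) (f : ι → κ) (g : κ → τ) :
    fiberSum (fiberSum p f) g = fiberSum p (g ∘ f) := by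
  ext t
  simp only [fiberSum, sum_filter, ← sum_fiberwise univ f fun i => if (g ∘ f) i = t then p i else 0]
  refine sum_congr rfl fun k _ => ?_
  by_cases hk : g k = t
  · rw [if_pos hk]
    exact sum_congr rfl fun i _ => by aesop
  · rw [if_neg hk]
    exact (sum_eq_zero fun i _ => by aesop).symm

end FiberSum

section Entropy

lemma entropy_eq_sum_negMulLog [Fintype ι] (a : ι → ℝ) :
    entropy a = (∑ i, negMulLog (a i)) / log 2 := by
  simp only [entropy, negMulLog, logb, sum_div, ← sum_neg_distrib, mul_div_assoc', neg_mul, neg_div]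

lemma negMulLog_sum_le {s : Finset ι} {a : ι → ℝ} (ha : ∀ i ∈ s, 0 ≤ a i) :
    negMulLog (∑ i ∈ s, a i) ≤ ∑ i ∈ s, negMulLog (a i) := by
  rw [negMulLog, neg_mul, sum_mul, ← sum_neg_distrib]
  refine sum_le_sum fun i hi => ?_
  rcases (ha i hi).eq_or_lt with h | h
  · simp [← h]
  · rw [negMulLog, neg_mul, neg_le_neg_iff]
    exact mul_le_mul_of_nonneg_left (log_le_log h (single_le_sum ha hi)) h.le

variable [Fintype ι] [Fintype κ]

lemma entropy_le_entropy_of_mem_couplings {p : ι → ℝ} {q : κ → ℝ} {N : ι × κ → ℝ}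
    (hN : N ∈ couplings p q) : entropy p ≤ entropy N := by
  rw [entropy_eq_sum_negMulLog, entropy_eq_sum_negMulLog, Fintype.sum_prod_type]
  refine div_le_div_of_nonneg_right (sum_le_sum fun i _ => ?_) (log_pos one_lt_two).le
  rw [← hN.2.1 i]
  exact negMulLog_sum_le fun j _ => hN.1.1 _

lemma sum_negMulLog_fiberSum_le [DecidableEq κ] {p : ι → ℝ} (hp : 0 ≤ p) (f : ι → κ) :
    ∑ k, negMulLog (fiberSum p f k) ≤ ∑ i, negMulLog (p i) :=
  calc ∑ k, negMulLog (fiberSum p f k) ≤ ∑ k, ∑ i with f i = k, negMulLog (p i) :=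
        sum_le_sum fun _ _ => negMulLog_sum_le fun i _ => hp i
    _ = ∑ i, negMulLog (p i) := sum_fiberwise _ _ _

end Entropy

section GraphCoupling

variable [DecidableEq κ]

/-- The joint distribution of `(X, f X)` when `X` has distribution `p`. -/
noncomputable def graphCoupling (p : ι → ℝ) (f : ι → κ) (x : ι × κ) : ℝ :=
  Pi.single (M := fun _ => ℝ) (f x.1) (p x.1) x.2

lemma graphCoupling_nonneg {p : ι → ℝ} (hp : 0 ≤ p) (f : ι → κ) : 0 ≤ graphCoupling p f := fun x =>
  (Pi.single_nonneg (α := fun _ => ℝ)).2 (hp x.1) x.2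

lemma sum_graphCoupling_fst [Fintype ι] (p : ι → ℝ) (f : ι → κ) (k : κ) :
    ∑ i, graphCoupling p f (i, k) = fiberSum p f k := by
  simp [graphCoupling, fiberSum, sum_filter, Pi.single_apply, eq_comm]

variable [Fintype κ]

lemma sum_graphCoupling_snd (p : ι → ℝ) (f : ι → κ) (i : ι) :
    ∑ k, graphCoupling p f (i, k) = p i := by
  simp [graphCoupling]

variable [Fintype ι]

lemma graphCoupling_mem_couplings {p : ι → ℝ} (hp : p ∈ stdSimplex ℝ ι) (f : ι → κ) :
    graphCoupling p f ∈ couplings p (fiberSum p f) :=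
  ⟨⟨graphCoupling_nonneg hp.1 f, by simp [Fintype.sum_prod_type, sum_graphCoupling_snd, hp.2]⟩,
    sum_graphCoupling_snd p f, sum_graphCoupling_fst p f⟩

lemma entropy_graphCoupling (p : ι → ℝ) (f : ι → κ) : entropy (graphCoupling p f) = entropy p := by
  simp [entropy_eq_sum_negMulLog, graphCoupling, Fintype.sum_prod_type, Pi.single_apply,
    apply_ite negMulLog]

lemma minJointEntropy_fiberSum {p : ι → ℝ} (hp : p ∈ stdSimplex ℝ ι) (f : ι → κ) :
    minJointEntropy p (fiberSum p f) = entropy p := by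
  obtain ⟨⟨N, hN, hNW⟩, hW⟩ := isLeast_minJointEntropy hp (fiberSum_mem_stdSimplex hp f)
  exact le_antisymm (hW ⟨_, graphCoupling_mem_couplings hp f, entropy_graphCoupling p f⟩)
    (hNW ▸ entropy_le_entropy_of_mem_couplings hN)

lemma dist_fiberSum {p : ι → ℝ} (hp : p ∈ stdSimplex ℝ ι) (f : ι → κ) :
    dist p (fiberSum p f) = entropy p - entropy (fiberSum p f) := by
  rw [dist, minJointEntropy_fiberSum hp f]
  ring

end GraphCoupling

section ConditionalEntropy

lemma perspective_add_le {φ : ℝ → ℝ} (hφ : ConcaveOn ℝ (Set.Ici 0) φ) {x y r s : ℝ}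
    (hx : 0 ≤ x) (hxr : x ≤ r) (hy : 0 ≤ y) (hys : y ≤ s) :
    r * φ (x / r) + s * φ (y / s) ≤ (r + s) * φ ((x + y) / (r + s)) := by
  have hr := hx.trans hxr
  have hs := hy.trans hys
  rcases (add_nonneg hr hs).eq_or_lt with h0 | hpos
  · obtain ⟨rfl, rfl⟩ := (add_eq_zero_iff_of_nonneg hr hs).1 h0.symm
    simp
  have hcancel {u t : ℝ} (h : t = 0 → u = 0) : t / (r + s) * (u / t) = u / (r + s) := by
    rcases eq_or_ne t 0 with rfl | ht
    · simp [h rfl]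
    · field_simp
  have hmean : r / (r + s) * (x / r) + s / (r + s) * (y / s) = (x + y) / (r + s) := by
    rw [hcancel fun h => le_antisymm (h ▸ hxr) hx, hcancel fun h => le_antisymm (h ▸ hys) hy,
      add_div]
  have hconc := hφ.2 (div_nonneg hx hr) (div_nonneg hy hs) (div_nonneg hr hpos.le)
    (div_nonneg hs hpos.le) (by rw [← add_div, div_self hpos.ne'])
  simp only [smul_eq_mul, hmean] at hconc
  calc r * φ (x / r) + s * φ (y / s)
      = (r + s) * (r / (r + s) * φ (x / r) + s / (r + s) * φ (y / s)) := by
        field_simp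
    _ ≤ (r + s) * φ ((x + y) / (r + s)) := mul_le_mul_of_nonneg_left hconc hpos.le

variable [Fintype κ]

lemma mem_convexHull_range_single [DecidableEq κ] [Nonempty κ] {v : κ → ℝ} (hv : 0 ≤ v) :
    v ∈ convexHull ℝ (Set.range fun k => Pi.single (M := fun _ => ℝ) k (∑ j, v j)) := by
  set r := ∑ j, v j with hr
  rcases eq_or_ne r 0 with h0 | h0
  · have hv0 : v = 0 := funext fun k =>
      (sum_eq_zero_iff_of_nonneg fun j _ => hv j).1 (hr.symm.trans h0) k (mem_univ k)
    exact subset_convexHull ℝ _ ⟨Classical.arbitrary κ, by simp [hv0, h0]⟩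
  · have hsum : ∑ k, (v k / r) • Pi.single (M := fun _ => ℝ) k r = v := by
      ext j
      simp [Pi.single_apply, h0]
    rw [← hsum]
    exact (convex_convexHull ℝ _).sum_mem
      (fun k _ => div_nonneg (hv k) (sum_nonneg fun j _ => hv j))
      (by rw [← sum_div, div_self h0]) fun k _ => subset_convexHull ℝ _ ⟨k, rfl⟩

lemma mem_convexHull_range_graphCoupling [Finite ι] [DecidableEq κ] [Nonempty κ] {N : ι × κ → ℝ}
    (hN : 0 ≤ N) :
    N ∈ convexHull ℝ (Set.range (graphCoupling (κ := κ) fun i => ∑ k, N (i, k))) := by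
  have hcurry : (fun i k => N (i, k)) ∈ convexHull ℝ (Set.univ.pi fun i =>
      Set.range fun k => Pi.single (M := fun _ => ℝ) k (∑ j, N (i, j))) := by
    rw [convexHull_pi]
    exact fun i _ => mem_convexHull_range_single fun k => hN (i, k)
  have himage := Set.mem_image_of_mem (LinearEquiv.curry ℝ ℝ ι κ).symm.toLinearMap hcurry
  rw [LinearMap.image_convexHull] at himage
  refine convexHull_mono ?_ himage
  rintro _ ⟨M, hM, rfl⟩
  choose f hf using fun i => hM i (Set.mem_univ i)
  exact ⟨f, funext fun x => congr_fun (hf x.1) x.2⟩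

variable [Fintype ι]

/-- The conditional entropy `H(X | Y) = H(X, Y) - H(Y)` when `(X, Y)` has joint distribution `N`. -/
noncomputable def condEntropy (N : ι × κ → ℝ) : ℝ :=
  entropy N - entropy fun k => ∑ i, N (i, k)

lemma condEntropy_graphCoupling [DecidableEq κ] (p : ι → ℝ) (f : ι → κ) :
    condEntropy (graphCoupling p f) = entropy p - entropy (fiberSum p f) := by
  simp only [condEntropy, entropy_graphCoupling, sum_graphCoupling_fst]

lemma mul_negMulLog_div {x r : ℝ} (h : r = 0 → x = 0) :
    r * negMulLog (x / r) = negMulLog x + x * log r := by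
  rcases eq_or_ne x 0 with rfl | hx
  · simp
  · have hr := mt h hx
    rw [negMulLog, log_div hx hr, negMulLog]
    field_simp
    ring

lemma condEntropy_eq_sum_perspective {N : ι × κ → ℝ} (hN : 0 ≤ N) :
    condEntropy N =
      (∑ k, ∑ i, (∑ j, N (j, k)) * negMulLog (N (i, k) / ∑ j, N (j, k))) / log 2 := by
  have hcol (i : ι) (k : κ) (h : ∑ j, N (j, k) = 0) : N (i, k) = 0 :=
    (sum_eq_zero_iff_of_nonneg fun j _ => hN (j, k)).1 h i (mem_univ i)
  simp only [mul_negMulLog_div (hcol _ _), sum_add_distrib, ← sum_mul]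
  rw [condEntropy, entropy_eq_sum_negMulLog, entropy_eq_sum_negMulLog, Fintype.sum_prod_type_right,
    ← sub_div, sub_eq_add_neg, ← sum_neg_distrib]
  simp only [negMulLog, neg_mul, neg_neg]

lemma condEntropy_smul {c : ℝ} (hc : 0 ≤ c) {N : ι × κ → ℝ} (hN : 0 ≤ N) :
    condEntropy (c • N) = c * condEntropy N := by
  rcases hc.eq_or_lt with rfl | hc'
  · simp [condEntropy, entropy]
  · rw [condEntropy_eq_sum_perspective hN, condEntropy_eq_sum_perspective (smul_nonneg hc hN)]
    simp only [Pi.smul_apply, smul_eq_mul, ← mul_sum, mul_div_mul_left _ _ hc'.ne', mul_assoc,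
      mul_div_assoc]

lemma condEntropy_add_le {M N : ι × κ → ℝ} (hM : 0 ≤ M) (hN : 0 ≤ N) :
    condEntropy M + condEntropy N ≤ condEntropy (M + N) := by
  rw [condEntropy_eq_sum_perspective hM, condEntropy_eq_sum_perspective hN,
    condEntropy_eq_sum_perspective (add_nonneg hM hN), ← add_div]
  refine div_le_div_of_nonneg_right ?_ (log_pos one_lt_two).le
  have hle (N : ι × κ → ℝ) (hN : 0 ≤ N) (i : ι) (k : κ) : N (i, k) ≤ ∑ j, N (j, k) :=
    single_le_sum (f := fun j => N (j, k)) (fun j _ => hN (j, k)) (mem_univ i)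
  simp only [Pi.add_apply, sum_add_distrib]
  rw [← sum_add_distrib]
  refine sum_le_sum fun k _ => ?_
  rw [← sum_add_distrib]
  exact sum_le_sum fun i _ =>
    perspective_add_le concaveOn_negMulLog (hM _) (hle M hM i k) (hN _) (hle N hN i k)

lemma concaveOn_condEntropy : ConcaveOn ℝ {N : ι × κ → ℝ | 0 ≤ N} condEntropy := by
  refine ⟨convex_Ici 0, fun M hM N hN a b ha hb _ => ?_⟩
  rw [smul_eq_mul, smul_eq_mul, ← condEntropy_smul ha hM, ← condEntropy_smul hb hN]
  exact condEntropy_add_le (smul_nonneg ha hM) (smul_nonneg hb hN)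

lemma exists_entropy_sub_entropy_fiberSum_le_condEntropy [DecidableEq κ] [Nonempty κ]
    {N : ι × κ → ℝ} (hN : 0 ≤ N) :
    ∃ f : ι → κ, entropy (fun i => ∑ k, N (i, k)) - entropy (fiberSum (fun i => ∑ k, N (i, k)) f) ≤
      condEntropy N := by
  have hgraph : Set.range (graphCoupling (κ := κ) fun i => ∑ k, N (i, k)) ⊆ {N | 0 ≤ N} :=
    Set.range_subset_iff.2 <| graphCoupling_nonneg fun i => sum_nonneg fun k _ => hN (i, k)
  obtain ⟨_, ⟨f, rfl⟩, hf⟩ := concaveOn_condEntropy.exists_le_of_mem_convexHull hgraph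
    (mem_convexHull_range_graphCoupling hN)
  exact ⟨f, (condEntropy_graphCoupling _ f).symm.trans_le hf⟩

lemma exists_dist_fiberSum_le [DecidableEq κ] [Nonempty κ] {p : ι → ℝ} {q : κ → ℝ}
    (hp : p ∈ stdSimplex ℝ ι) (hq : q ∈ stdSimplex ℝ κ) :
    ∃ f : ι → κ, dist p (fiberSum p f) ≤ dist p q := by
  obtain ⟨N, hN, hNW⟩ := (isLeast_minJointEntropy hp hq).1
  obtain ⟨f, hf⟩ := exists_entropy_sub_entropy_fiberSum_le_condEntropy hN.1.1
  simp only [condEntropy, hN.2.1, hN.2.2] at hf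
  have hpN := entropy_le_entropy_of_mem_couplings hN
  refine ⟨f, ?_⟩
  rw [dist_fiberSum hp, dist, ← hNW]
  linarith

end ConditionalEntropy

lemma exists_isBestApprox {n m : ℕ} [Nonempty (Fin m)] {p : Fin n → ℝ}
    (hp : p ∈ stdSimplex ℝ (Fin n)) : ∃ q : Fin m → ℝ, IsBestApprox p q := by
  obtain ⟨f, hf⟩ := Finite.exists_min fun f : Fin n → Fin m => dist p (fiberSum p f)
  refine ⟨fiberSum p f, fiberSum_mem_stdSimplex hp f, fun q hq => ?_⟩
  obtain ⟨g, hg⟩ := exists_dist_fiberSum_le hp hq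
  exact (hf g).trans hg

section TangentDefect

/-- The difference at `t` between `t ↦ -t log t` and its tangent at `c`. -/
noncomputable def tangentDefect (c t : ℝ) : ℝ := negMulLog t + t * log c + t - c

lemma concaveOn_tangentDefect (c : ℝ) : ConcaveOn ℝ (Set.Ici 0) (tangentDefect c) :=
  ((concaveOn_negMulLog.add ((LinearMap.mulRight ℝ (log c)).concaveOn (convex_Ici 0))).add
    (concaveOn_id (convex_Ici 0))).sub (convexOn_const c (convex_Ici 0))

lemma tangentDefect_nonpos {c t : ℝ} (hc : 0 < c) (ht : 0 ≤ t) : tangentDefect c t ≤ 0 := by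
  rcases ht.eq_or_lt with rfl | ht
  · simp [tangentDefect, hc.le]
  · have hlog : t * (log c - log t) ≤ c - t :=
      calc t * (log c - log t) = t * log (c / t) := by rw [log_div hc.ne' ht.ne']
        _ ≤ t * (c / t - 1) := by gcongr; exact log_le_sub_one_of_pos (div_pos hc ht)
        _ = c - t := by field_simp
    rw [tangentDefect, negMulLog]
    linarith

lemma antitoneOn_tangentDefect {c : ℝ} (hc : 0 < c) :
    AntitoneOn (tangentDefect c) (Set.Ici c) := by
  intro s (hs : c ≤ s) t _ hst
  have hs0 := hc.trans_le hs
  have hchange : tangentDefect c t =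
      tangentDefect c s + tangentDefect s t - (t - s) * (log s - log c) := by
    simp only [tangentDefect, negMulLog]
    ring
  have hslope : 0 ≤ (t - s) * (log s - log c) :=
    mul_nonneg (sub_nonneg.2 hst) (sub_nonneg.2 (log_le_log hc hs))
  linarith [tangentDefect_nonpos hs0 (hs0.le.trans hst)]

lemma two_mul_mul_div_add_le {a b : ℝ} (ha : 0 < a) (hb : 0 < b) :
    2 * (a * b / (a + b)) ≤ negMulLog a + negMulLog b - negMulLog (a + b) := by
  have hgain {x y : ℝ} (hx : 0 < x) (hy : 0 < y) :
      x * y / (x + y) ≤ x * log (x + y) - x * log x :=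
    calc x * y / (x + y) = x * (1 - ((x + y) / x)⁻¹) := by field_simp; ring
      _ ≤ x * log ((x + y) / x) := by
        gcongr
        exact one_sub_inv_le_log_of_pos (by positivity)
      _ = x * log (x + y) - x * log x := by rw [log_div (by positivity) hx.ne', mul_sub]
  have hba := hgain hb ha
  rw [add_comm b a, mul_comm b a] at hba
  simp only [negMulLog]
  linarith [hgain ha hb]

lemma tangentDefect_add_le {c a b : ℝ} (hc : 0 < c) (ha : c ≤ a) (hb : c ≤ b) :
    tangentDefect c (a + b) ≤ tangentDefect c a + tangentDefect c b := by
  have ha0 := hc.trans_le ha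
  have hb0 := hc.trans_le hb
  have hharmonic : c ≤ 2 * (a * b / (a + b)) := by
    rw [← mul_div_assoc, le_div_iff₀ (by positivity)]
    nlinarith
  simp only [tangentDefect]
  linarith [two_mul_mul_div_add_le ha0 hb0]

lemma tangentDefect_le_sum {c : ℝ} (hc : 0 < c) {p : ι → ℝ} {s : Finset ι}
    (hp : ∀ i ∈ s, c ≤ p i) {t : ℝ} (ht : ∑ i ∈ s, p i ≤ t) :
    tangentDefect c t ≤ ∑ i ∈ s, tangentDefect c (p i) := by
  rcases s.eq_empty_or_nonempty with rfl | hs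
  · simpa using tangentDefect_nonpos hc (by simpa using ht)
  have hsum : c ≤ ∑ i ∈ s, p i := by
    obtain ⟨i, hi⟩ := hs
    exact (hp i hi).trans (single_le_sum (fun j hj => hc.le.trans (hp j hj)) hi)
  calc tangentDefect c t ≤ tangentDefect c (∑ i ∈ s, p i) :=
        antitoneOn_tangentDefect hc hsum (hsum.trans ht) ht
    _ ≤ ∑ i ∈ s, tangentDefect c (p i) :=
        le_sum_nonempty_of_subadditive_on_pred (tangentDefect c) (c ≤ ·)
          (fun _ _ => tangentDefect_add_le hc)
          (fun _ _ hx hy => le_add_of_le_of_nonneg hx (hc.le.trans hy)) p s hs hp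

lemma sum_tangentDefect [Fintype κ] (c : ℝ) {r : κ → ℝ} (hr : ∑ k, r k = 1) :
    ∑ k, tangentDefect c (r k) =
      ∑ k, negMulLog (r k) + (log c + 1 - Fintype.card κ * c) := by
  simp only [tangentDefect, sum_sub_distrib, sum_add_distrib, ← sum_mul, hr, sum_const,
    card_univ, nsmul_eq_mul]
  ring

lemma sum_tangentDefect_fiberSum_le [Fintype ι] [Fintype κ] [DecidableEq κ] {c : ℝ} (hc : 0 < c)
    {p : ι → ℝ} (hp : 0 ≤ p) {s : Finset ι} (hs : ∀ i ∈ s, c ≤ p i) (g : ι → κ) :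
    ∑ k, tangentDefect c (fiberSum p g k) ≤ ∑ i ∈ s, tangentDefect c (p i) := by
  rw [← sum_fiberwise s g]
  exact sum_le_sum fun k _ => tangentDefect_le_sum hc (fun i hi => hs i (mem_filter.1 hi).1)
    (sum_le_sum_of_subset_of_nonneg (filter_subset_filter _ (subset_univ s)) fun i _ _ => hp i)

end TangentDefect

section Alpha

lemma alpha_mul_log_two : alpha * log 2 = log 2 - 1 - log (log 2) := by
  have hlog2 : log 2 ≠ 0 := (log_pos one_lt_two).ne'
  rw [alpha]
  field_simp
  ring

lemma alpha_nonneg : 0 ≤ alpha := by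
  have hlog2 := log_pos one_lt_two
  refine nonneg_of_mul_nonneg_left ?_ hlog2
  rw [alpha_mul_log_two]
  linarith [log_le_sub_one_of_pos hlog2]

lemma neg_lt_log_log_two : -0.36652 < log (log 2) := by
  have hexp : (1.4427 : ℝ) ≤ exp 0.36652 :=
    (sum_le_exp_of_nonneg (by norm_num) 8).trans' (by norm_num [sum_range_succ, Nat.factorial])
  rw [lt_log_iff_exp_lt (log_pos one_lt_two), exp_neg]
  calc (exp 0.36652)⁻¹ ≤ 1.4427⁻¹ := inv_anti₀ (by norm_num) hexp
    _ < 0.6931471803 := by norm_num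
    _ < log 2 := log_two_gt_d9

lemma alpha_lt : alpha < 0.0861 := by
  refine lt_of_mul_lt_mul_right ?_ (log_pos one_lt_two).le
  rw [alpha_mul_log_two]
  linarith [neg_lt_log_log_two, log_two_lt_d9]

-- The point `2 μ log 2` and the constant `α` are chosen so that the right-hand side, a concave
-- function of `t`, vanishes at both end points of `[μ, 2 μ]`.
lemma tangentDefect_add_alpha_nonneg {μ t : ℝ} (hμ : 0 < μ) (ht : t ∈ Set.Icc μ (2 * μ)) :
    0 ≤ tangentDefect (2 * log 2 * μ) t + alpha * log 2 * t := by
  have hlog2 := log_pos one_lt_two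
  have hconcave : ConcaveOn ℝ (Set.Ici 0)
      fun t => tangentDefect (2 * log 2 * μ) t + alpha * log 2 * t :=
    (concaveOn_tangentDefect _).add
      ((LinearMap.mulLeft ℝ (alpha * log 2)).concaveOn (convex_Ici 0))
  have hlog : log (2 * log 2 * μ) = log 2 + log (log 2) + log μ := by
    rw [log_mul (by positivity) hμ.ne', log_mul two_ne_zero hlog2.ne']
  have hleft : tangentDefect (2 * log 2 * μ) μ + alpha * log 2 * μ = 0 := by
    rw [tangentDefect, alpha_mul_log_two, negMulLog, hlog]
    ring
  have hright : tangentDefect (2 * log 2 * μ) (2 * μ) + alpha * log 2 * (2 * μ) = 0 := by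
    rw [tangentDefect, alpha_mul_log_two, negMulLog, hlog, log_mul two_ne_zero hμ.ne']
    ring
  have hmin := hconcave.min_le_of_mem_Icc (Set.mem_Ici.2 hμ.le)
    (Set.mem_Ici.2 (by positivity)) ht
  rwa [hleft, hright, min_self] at hmin

end Alpha

/-- `q` lists the sums of `p` over the nonempty blocks of the partition into fibres of `f`, and the
sum over a block with at least two elements is at most twice the sum over any block. This is the
property of the output of the Huffman algorithm that the entropy bound uses. -/
structure IsBalancedAggregation [Fintype ι] [DecidableEq κ] (p : ι → ℝ) (q : κ → ℝ) (f : ι → κ) :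
    Prop where
  surjective : Function.Surjective f
  fiberSum_eq : fiberSum p f = q
  le_two_mul : ∀ ⦃i j⦄, i ≠ j → f i = f j → ∀ k, q (f i) ≤ 2 * q k

namespace IsBalancedAggregation

variable [Fintype ι] [DecidableEq κ] {p : ι → ℝ} {q : κ → ℝ} {f : ι → κ}

lemma nonneg (hf : IsBalancedAggregation p q f) (hp : 0 ≤ p) : 0 ≤ q :=
  hf.fiberSum_eq ▸ fiberSum_nonneg hp f

lemma of_equiv (e : ι ≃ κ) (he : ∀ i, q (e i) = p i) : IsBalancedAggregation p q e where
  surjective := e.surjective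
  fiberSum_eq := funext fun k => by
    obtain ⟨i, rfl⟩ := e.surjective k
    rw [fiberSum_apply_of_forall_eq fun j h => e.injective h, he]
  le_two_mul _ _ hij h := absurd (e.injective h) hij

lemma comp [Fintype κ] [DecidableEq τ] {r : τ → ℝ} {g : κ → τ} (hq : 0 ≤ q)
    (hg : IsBalancedAggregation q r g) (hf : IsBalancedAggregation p q f) :
    IsBalancedAggregation p r (g ∘ f) where
  surjective := hg.surjective.comp hf.surjective
  fiberSum_eq := by rw [← fiberSum_fiberSum, hf.fiberSum_eq, hg.fiberSum_eq]
  le_two_mul i j hij h t := by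
    by_cases hsingle : ∀ k, g k = g (f i) → k = f i
    · obtain ⟨k, rfl⟩ := hg.surjective t
      calc r (g (f i)) = q (f i) := by
            rw [← hg.fiberSum_eq, fiberSum_apply_of_forall_eq hsingle]
        _ ≤ 2 * q k := hf.le_two_mul hij (hsingle _ h.symm).symm k
        _ ≤ 2 * r (g k) := by
            rw [← hg.fiberSum_eq]
            linarith [le_fiberSum hq g k]
    · push Not at hsingle
      obtain ⟨k, hk, hne⟩ := hsingle
      exact hg.le_two_mul hne.symm hk.symm t

section EntropyBound

variable (hf : IsBalancedAggregation p q f) {k₀ : κ}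
include hf

lemma apply_eq_of_two_mul_lt {i : ι} (hi : 2 * q k₀ < q (f i)) : q (f i) = p i := by
  rw [← hf.fiberSum_eq]
  refine fiberSum_apply_of_forall_eq fun j hj => ?_
  by_contra hji
  exact (hf.le_two_mul (Ne.symm hji) hj.symm k₀).not_gt hi

variable [Fintype κ]

lemma sum_filter_two_mul_lt (k₀ : κ) (F : ℝ → ℝ) :
    ∑ i with 2 * q k₀ < q (f i), F (p i) = ∑ k with 2 * q k₀ < q k, F (q k) := by
  refine sum_bij (fun i _ => f i) (by simp) (fun i hi j _ hij => ?_) (fun k hk => ?_) fun i hi => ?_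
  · by_contra hne
    exact (hf.le_two_mul hne hij k₀).not_gt (mem_filter.1 hi).2
  · obtain ⟨i, rfl⟩ := hf.surjective k
    exact ⟨i, by simpa using hk, rfl⟩
  · rw [hf.apply_eq_of_two_mul_lt (mem_filter.1 hi).2]

lemma sum_negMulLog_eq_of_eq_zero (hp : 0 ≤ p) (hk₀ : q k₀ = 0) :
    ∑ k, negMulLog (q k) = ∑ i, negMulLog (p i) := by
  have hsum := hf.sum_filter_two_mul_lt k₀ negMulLog
  have hpos_q (k : κ) (hk : negMulLog (q k) ≠ 0) : 2 * q k₀ < q k := by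
    have hqk : q k ≠ 0 := fun h => hk (by simp [h])
    simpa [hk₀] using (hf.nonneg hp k).lt_of_ne' hqk
  have hpos_p (i : ι) (hi : negMulLog (p i) ≠ 0) : 2 * q k₀ < q (f i) := by
    have hpi : p i ≠ 0 := fun h => hi (by simp [h])
    have hle : p i ≤ q (f i) := hf.fiberSum_eq ▸ le_fiberSum hp f i
    simpa [hk₀] using ((hp i).lt_of_ne' hpi).trans_le hle
  rwa [sum_filter_of_ne fun i _ => hpos_p i, sum_filter_of_ne fun k _ => hpos_q k, eq_comm] at hsum

end EntropyBound

end IsBalancedAggregation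

lemma sum_filter_two_mul_lt_tangentDefect_le [Fintype κ] {q : κ → ℝ} (hq : q ∈ stdSimplex ℝ κ)
    {k₀ : κ} (hpos : 0 < q k₀) (hmin : ∀ k, q k₀ ≤ q k) :
    ∑ k with 2 * q k₀ < q k, tangentDefect (2 * log 2 * q k₀) (q k) ≤
      ∑ k, tangentDefect (2 * log 2 * q k₀) (q k) + alpha * log 2 := by
  set c := 2 * log 2 * q k₀
  have hsmall : 0 ≤ ∑ k with ¬ 2 * q k₀ < q k, (tangentDefect c (q k) + alpha * log 2 * q k) :=
    sum_nonneg fun k hk =>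
      tangentDefect_add_alpha_nonneg hpos ⟨hmin k, not_lt.1 (mem_filter.1 hk).2⟩
  have hmass : ∑ k with ¬ 2 * q k₀ < q k, q k ≤ 1 :=
    hq.2 ▸ sum_le_univ_sum_of_nonneg hq.1
  have hα := mul_nonneg alpha_nonneg (log_pos one_lt_two).le
  rw [sum_add_distrib, ← mul_sum] at hsmall
  rw [← sum_filter_add_sum_filter_not univ (fun k => 2 * q k₀ < q k)]
  linarith [mul_le_mul_of_nonneg_left hmass hα]

lemma IsBalancedAggregation.sum_negMulLog_fiberSum_le [Fintype ι] [Fintype κ] [Nonempty κ]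
    [DecidableEq κ] {p : ι → ℝ} {q : κ → ℝ} {f : ι → κ} (hp : p ∈ stdSimplex ℝ ι)
    (hf : IsBalancedAggregation p q f) (g : ι → κ) :
    ∑ k, negMulLog (fiberSum p g k) ≤ ∑ k, negMulLog (q k) + alpha * log 2 := by
  have hq : q ∈ stdSimplex ℝ κ := hf.fiberSum_eq ▸ fiberSum_mem_stdSimplex hp f
  obtain ⟨k₀, hmin⟩ := Finite.exists_min q
  rcases (hq.1 k₀).eq_or_lt with hzero | hpos
  · rw [hf.sum_negMulLog_eq_of_eq_zero hp.1 hzero.symm]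
    exact le_add_of_le_of_nonneg (HuffmanApprox.sum_negMulLog_fiberSum_le hp.1 g)
      (mul_nonneg alpha_nonneg (log_pos one_lt_two).le)
  set c := 2 * log 2 * q k₀
  have hc0 : 0 < c := mul_pos (mul_pos two_pos (log_pos one_lt_two)) hpos
  have hc_le : c ≤ 2 * q k₀ := by
    nlinarith [log_two_lt_d9]
  have hlarge : ∀ i ∈ ({i | 2 * q k₀ < q (f i)} : Finset ι), c ≤ p i := fun i hi => by
    rw [← hf.apply_eq_of_two_mul_lt (mem_filter.1 hi).2]
    exact hc_le.trans (mem_filter.1 hi).2.le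
  have hdefect : ∑ k, tangentDefect c (fiberSum p g k) ≤
      ∑ k, tangentDefect c (q k) + alpha * log 2 :=
    calc ∑ k, tangentDefect c (fiberSum p g k)
        ≤ ∑ i with 2 * q k₀ < q (f i), tangentDefect c (p i) :=
          sum_tangentDefect_fiberSum_le hc0 hp.1 hlarge g
      _ = ∑ k with 2 * q k₀ < q k, tangentDefect c (q k) := hf.sum_filter_two_mul_lt k₀ _
      _ ≤ ∑ k, tangentDefect c (q k) + alpha * log 2 :=
          sum_filter_two_mul_lt_tangentDefect_le hq hpos hmin
  rw [sum_tangentDefect c (fiberSum_mem_stdSimplex hp g).2, sum_tangentDefect c hq.2] at hdefect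
  linarith

lemma IsBalancedAggregation.dist_le_add_alpha [Fintype ι] [Fintype κ] [Nonempty κ]
    [DecidableEq κ] {p : ι → ℝ} {q : κ → ℝ} {f : ι → κ} (hp : p ∈ stdSimplex ℝ ι)
    (hf : IsBalancedAggregation p q f) {r : κ → ℝ} (hr : r ∈ stdSimplex ℝ κ) :
    dist p q ≤ dist p r + alpha := by
  obtain ⟨g, hg⟩ := exists_dist_fiberSum_le hp hr
  have hlog2 := log_pos one_lt_two
  have hent : entropy (fiberSum p g) ≤ entropy q + alpha := by
    rw [entropy_eq_sum_negMulLog, entropy_eq_sum_negMulLog, div_add' _ _ _ hlog2.ne']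
    exact div_le_div_of_nonneg_right (hf.sum_negMulLog_fiberSum_le hp g) hlog2.le
  have hdist : dist p q = entropy p - entropy q := hf.fiberSum_eq ▸ dist_fiberSum hp f
  rw [dist_fiberSum hp] at hg
  linarith

section HuffmanAlgorithm

lemma exists_cons_forall_le {α : Type*} [LinearOrder α] {s : Multiset α} (hs : s ≠ 0) :
    ∃ x u, s = x ::ₘ u ∧ ∀ z ∈ u, x ≤ z := by
  obtain ⟨x, hx, hmin⟩ := s.exists_min_image id hs
  obtain ⟨u, rfl⟩ := Multiset.exists_cons_of_mem hx
  exact ⟨x, u, rfl, fun z hz => hmin z (Multiset.mem_cons_of_mem hz)⟩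

lemma exists_huffmanStep {s : Multiset ℝ} (hs : 2 ≤ s.card) :
    ∃ t, HuffmanStep s t ∧ t.card + 1 = s.card := by
  obtain ⟨x, s, rfl, hx⟩ := exists_cons_forall_le (s := s) (by rintro rfl; simp at hs)
  obtain ⟨y, u, rfl, hy⟩ := exists_cons_forall_le (s := s) (by rintro rfl; simp at hs)
  exact ⟨(x + y) ::ₘ u, ⟨x, y, u, rfl, hx y (u.mem_cons_self y), hy, rfl⟩, by simp⟩

lemma exists_huffmanSteps {k : ℕ} {s : Multiset ℝ} (hks : k < s.card) :
    ∃ t, HuffmanSteps k s t ∧ t.card + k = s.card := by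
  induction k generalizing s with
  | zero => exact ⟨s, .zero s, rfl⟩
  | succ k ih =>
    obtain ⟨t, hst, ht⟩ := exists_huffmanStep (s := s) (by lia)
    obtain ⟨u, htu, hu⟩ := ih (s := t) (by lia)
    exact ⟨u, .succ hst htu, by lia⟩

lemma exists_antitone_map_univ_eq {α : Type*} [LinearOrder α] (s : Multiset α) :
    ∃ q : Fin s.card → α, Antitone q ∧ univ.val.map q = s := by
  have hlen : (s.sort (· ≥ ·)).length = s.card := s.length_sort _
  rw [← hlen]
  exact ⟨(s.sort (· ≥ ·)).get, (s.pairwise_sort (· ≥ ·)).sortedGE.antitone_get,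
    by rw [Fin.univ_val_map, List.ofFn_get, Multiset.sort_eq]⟩

lemma exists_isHuffmanOutput {n m : ℕ} (hm : 1 ≤ m) (hmn : m ≤ n) (p : Fin n → ℝ) :
    ∃ q : Fin m → ℝ, IsHuffmanOutput p q := by
  obtain ⟨t, hpt, ht⟩ := exists_huffmanSteps (k := n - m) (s := univ.val.map p)
    (by simpa using by lia)
  obtain rfl : t.card = m := by simp at ht; lia
  obtain ⟨q, hq, hqt⟩ := exists_antitone_map_univ_eq t
  exact ⟨q, hq, hqt.symm ▸ hpt⟩

lemma exists_equiv_of_map_univ_eq {α : Type*} [Fintype ι] [Fintype κ]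
    {p : ι → α} {q : κ → α} (h : univ.val.map p = univ.val.map q) :
    ∃ e : ι ≃ κ, ∀ i, q (e i) = p i := by
  classical
  have hcard (a : α) : Fintype.card {i // p i = a} = Fintype.card {k // q k = a} := by
    have hcount := congrArg (Multiset.count a) h
    simpa [Multiset.count_map, Fintype.card_subtype, card_def, filter_val, eq_comm] using hcount
  exact ⟨Equiv.ofFiberEquiv fun a => Fintype.equivOfCardEq (hcard a), Equiv.ofFiberEquiv_map _⟩

lemma map_univ_option_elim {α : Type*} [Fintype ι] (x : α) (w : ι → α) :
    (univ : Finset (Option ι)).val.map (fun o => o.elim x w) = x ::ₘ univ.val.map w := by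
  simp [univ_option, insertNone, Function.comp_def]

lemma isBalancedAggregation_join [Fintype ι] [DecidableEq ι] {x y : ℝ} {w : ι → ℝ}
    (hpos : 0 ≤ x + y) (hxy : x ≤ y) (hy : ∀ i, y ≤ w i) :
    IsBalancedAggregation (fun o : Option (Option ι) => o.elim x fun o => o.elim y w)
      (fun o => o.elim (x + y) w) Option.join where
  surjective o := ⟨some o, rfl⟩
  fiberSum_eq := by
    funext o
    cases o <;> simp [fiberSum, sum_filter, Fintype.sum_option]
  le_two_mul i j hij h k := by
    have hnone : i.join = none := by
      rcases i with _ | _ | i <;> rcases j with _ | _ | j <;> simp_all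
    rw [hnone]
    rcases k with _ | k
    · exact le_mul_of_one_le_left hpos one_le_two
    · simpa using by linarith [hy k]

lemma HuffmanStep.exists_isBalancedAggregation [Fintype ι] [Fintype κ] [DecidableEq κ]
    {q : ι → ℝ} {r : κ → ℝ} (hq : 0 ≤ q)
    (h : HuffmanStep (univ.val.map q) (univ.val.map r)) :
    ∃ f : ι → κ, IsBalancedAggregation q r f := by
  classical
  obtain ⟨x, y, u, hs, hxy, hyu, ht⟩ := h
  rw [← u.map_univ_coe, ← map_univ_option_elim] at ht
  rw [← u.map_univ_coe, ← map_univ_option_elim, ← map_univ_option_elim] at hs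
  obtain ⟨e, he⟩ := exists_equiv_of_map_univ_eq hs
  obtain ⟨e', he'⟩ := exists_equiv_of_map_univ_eq ht.symm
  have hsplit : IsBalancedAggregation q
      (fun o : Option (Option u) => o.elim x fun o => o.elim y fun z => (z : ℝ)) e := .of_equiv e he
  have hnonneg := hsplit.nonneg hq
  have hmerge := isBalancedAggregation_join (add_nonneg (hnonneg none) (hnonneg (some none))) hxy
    (w := fun z : u => (z : ℝ)) fun z => hyu z Multiset.coe_mem
  have hf := hmerge.comp hnonneg hsplit
  have hrelabel : IsBalancedAggregation
      (fun o : Option u => o.elim (x + y) fun z => (z : ℝ)) r e' := .of_equiv e' he'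
  exact ⟨_, hrelabel.comp (hf.nonneg hq) hf⟩

lemma HuffmanSteps.exists_isBalancedAggregation {ι : Type} [Fintype ι] [Fintype κ] [DecidableEq κ]
    {k : ℕ} {p : ι → ℝ} {q : κ → ℝ} (hp : 0 ≤ p)
    (h : HuffmanSteps k (univ.val.map p) (univ.val.map q)) :
    ∃ f : ι → κ, IsBalancedAggregation p q f := by
  classical
  induction k generalizing ι with
  | zero =>
    generalize hs : univ.val.map p = s at h
    generalize ht : univ.val.map q = t at h
    cases h
    obtain ⟨e, he⟩ := exists_equiv_of_map_univ_eq (hs.trans ht.symm)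
    exact ⟨e, .of_equiv e he⟩
  | succ k ih =>
    obtain - | @⟨_, _, t, _, hstep, hsteps⟩ := h
    rw [← t.map_univ_coe] at hstep hsteps
    obtain ⟨f, hf⟩ := hstep.exists_isBalancedAggregation hp
    obtain ⟨g, hg⟩ := ih (hf.nonneg hp) hsteps
    exact ⟨g ∘ f, hg.comp (hf.nonneg hp) hf⟩

end HuffmanAlgorithm

end HuffmanApprox

theorem mainTheorem5 (n m : ℕ) (hm : 1 ≤ m) (hmn : m ≤ n)
    (p : Fin n → ℝ) (hp : p ∈ stdSimplex ℝ (Fin n)) :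
    (∃ qbar : Fin m → ℝ, HuffmanApprox.IsHuffmanOutput p qbar) ∧
    (∃ qstar : Fin m → ℝ, HuffmanApprox.IsBestApprox p qstar) ∧
    (∀ qbar : Fin m → ℝ, HuffmanApprox.IsHuffmanOutput p qbar →
      HuffmanApprox.IsAggregation p qbar ∧
      ∀ qstar : Fin m → ℝ, HuffmanApprox.IsBestApprox p qstar →
        HuffmanApprox.dist p qbar ≤ HuffmanApprox.dist p qstar + HuffmanApprox.alpha) ∧
    HuffmanApprox.alpha < 0.0861 := by
  have : Nonempty (Fin m) := ⟨⟨0, hm⟩⟩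
  refine ⟨HuffmanApprox.exists_isHuffmanOutput hm hmn p, HuffmanApprox.exists_isBestApprox hp,
    fun qbar hqbar => ?_, HuffmanApprox.alpha_lt⟩
  obtain ⟨f, hf⟩ := hqbar.2.exists_isBalancedAggregation hp.1
  have hagg : HuffmanApprox.IsAggregation p qbar :=
    ⟨f, hf.surjective, fun k => (congrFun hf.fiberSum_eq k).symm⟩
  exact ⟨hagg, fun qstar hqstar => hf.dist_le_add_alpha hp hqstar.1⟩
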